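/- Let $n\ge 1$ and let $\mathbf u=(u_1,\dots,u_n)\in\mathbb R^n_{\ge 0}\setminus\{\mathbf 0\}$ with $u_1\le u_2\le\dots\le u_n$. A vector $\mathbf a\in\mathbb R^n_{\ge 0}$ is a $\mathbf u$-parking function if its non-decreasing rearrangement $b_1\le\dots\le b_n$ satisfies $b_i\le u_i$ for all $i$; the parking function polytope $\mathrm{PF}(\mathbf u)\subset\mathbb R^n$ is the convex hull of all $\mathbf u$-parking functions. Then \[ \mathrm{PF}(\mathbf u)=\Big\{\mathbf x\in\mathbb R^n \;:\; x_i\ge 0 \text{ for all } i\in[n],\quad \sum_{i\in I}x_i\le \sum_{i=0}^{|I|-1}u_{n-i}\ \text{ for all } \emptyset\ne I\subseteq[n]\Big\}. \] An inequality $\mathbf a\cdot\mathbf x\le b$ valid on a polytope $P$ is said to define a facet of $P$ if $\{\mathbf x\in P:\mathbf a\cdot\mathbf x=b\}$ is a face of $P$ of dimension $\dim P-1$. For each $i\in[n]$, the inequality $x_i\ge 0$ defines a facet of $\mathrm{PF}(\mathbf u)$. For each nonempty $I\subseteq[n]$, whether the inequality $\sum_{i\in I}x_i\le\sum_{i=0}^{|I|-1}u_{n-i}$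 defines a facet of $\mathrm{PF}(\mathbf u)$ is determined as follows. \begin{enumerate} \item If $\mathbf u=(d,\dots,d)$ for some $d>0$, it defines a facet if and only if $|I|=1$. \item If $\mathbf u=(0,\dots,0,d)$ for some $d>0$, it defines a facet if and only if $|I|=n$. \item If $\mathbf u=(0,\dots,0,d,\dots,d)$ for some $d>0$, with at least one $0$ and at least two $d$'s, it defines a facet if and only if $|I|\in\{1,n\}$. \item If $\mathbf u$ contains at least two distinct positive entries, let $d_1<\dots<d_\ell$ be the distinct positive values among the entries of $\mathbf u$, let $m_0$ be the number of entries equal to $0$, and let $m_i$ be the number of entries equal to $d_i$ for $1\le i\le\ell$. Then it defines a facet if and only if $|I|\in\{1,n\}\cup[m_\ell+1,\,n-m_0-1]$, where $[p,q]$ denotes the set of integers $k$ with $p\le k\le q$ (empty if $p>q$). \end{enumerate} -/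

import Mathlib

open scoped Finset

/-- `a` is a `u`-parking function: its entries are nonnegative and its non-decreasing rearrangement
`b = a ∘ Tuple.sort a` satisfies `b i ≤ u i` for all `i`. -/
def IsParkingFunction {n : ℕ} (u a : Fin n → ℝ) : Prop :=
  (∀ i, 0 ≤ a i) ∧ ∀ i, (a ∘ Tuple.sort a) i ≤ u i

/-- The parking function polytope `PF(u)`: the convex hull of all `u`-parking functions. -/
def PF {n : ℕ} (u : Fin n → ℝ) : Set (Fin n → ℝ) :=
  convexHull ℝ {a | IsParkingFunction u a}

open Classical in
/-- The dimension of the affine span of a subset of `ℝⁿ`, with `dim ∅ = -1`. -/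
noncomputable def polyDim {n : ℕ} (P : Set (Fin n → ℝ)) : ℤ :=
  if P = ∅ then -1 else (Module.finrank ℝ (affineSpan ℝ P).direction : ℤ)

/-- Faces: the empty set and the sets of maximizers over `P` of linear functionals. -/
def IsFace {n : ℕ} (P F : Set (Fin n → ℝ)) : Prop :=
  F = ∅ ∨ ∃ h : Fin n → ℝ, F = {x | x ∈ P ∧ ∀ y ∈ P, h ⬝ᵥ y ≤ h ⬝ᵥ x}

/-- A facet of `P` is a face of dimension `dim P - 1`. -/
def IsFacet {n : ℕ} (P F : Set (Fin n → ℝ)) : Prop :=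
  IsFace P F ∧ polyDim F = polyDim P - 1

/-- The inequality `a ⬝ᵥ x ≤ b` is valid on `P` and defines a facet of `P`. -/
def DefinesFacet {n : ℕ} (P : Set (Fin n → ℝ)) (a : Fin n → ℝ) (b : ℝ) : Prop :=
  (∀ x ∈ P, a ⬝ᵥ x ≤ b) ∧ IsFacet P {x | x ∈ P ∧ a ⬝ᵥ x = b}

/-- The vector `e_I`, the sum of the standard basis vectors `e_i` over `i ∈ I`. -/
def indicatorVec {n : ℕ} (I : Finset (Fin n)) : Fin n → ℝ := fun i => if i ∈ I then 1 else 0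

/-- `u_n + u_{n-1} + ⋯ + u_{n-k+1}` (indices starting at `1`), for `k ≤ n`: the entry of `u` at
`j.rev` is `u_{n-j}`. -/
noncomputable def topSum {n : ℕ} (u : Fin n → ℝ) (k : ℕ) : ℝ :=
  ∑ j : Fin n with j.val < k, u j.rev

/-- The number of entries of `u` that are equal to `d`. -/
noncomputable def entryCount {n : ℕ} (u : Fin n → ℝ) (d : ℝ) : ℕ := #{i : Fin n | u i = d}

/-- The set of positive values appearing in `u`. -/
noncomputable def posValues {n : ℕ} (u : Fin n → ℝ) : Finset ℝ :=
  {d ∈ Finset.univ.image u | 0 < d}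

/-- The number `ℓ` of distinct positive values appearing in `u`. -/
noncomputable def numPosValues {n : ℕ} (u : Fin n → ℝ) : ℕ := (posValues u).card

/-- The data vector `(d_1, …, d_ℓ)`: the positive values appearing in `u`, in increasing order. -/
noncomputable def dataVector {n : ℕ} (u : Fin n → ℝ) : Fin (numPosValues u) → ℝ :=
  (posValues u).orderEmbOfFin rfl

/-- The multiplicity vector `(m_0, m_1, …, m_ℓ)`: `m_0` is the number of zeros of `u`, and `m_i` is
the number of entries of `u` equal to `d_i`. -/
noncomputable def multiplicityVector {n : ℕ} (u : Fin n → ℝ) : Fin (numPosValues u + 1) → ℕ :=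
  Fin.cons (entryCount u 0) fun i => entryCount u (dataVector u i)

/-! Parking functions are the nonnegative vectors lying below a rearrangement of `u`, and a sum of k
entries of `u` is at most the sum of its k largest, so `PF u` lies in the region. Conversely, on the
region the greedy choice bounds any linear functional: large coefficients receive large entries of
`u`, nonpositive ones receive 0. This choice is a parking function, so no hyperplane separates a
point of the region from `PF u` (`exists_perm_sum_mul_le`).

The region is full-dimensional, so an attained inequality defines a facet iff differences of its
equality points span the hyperplane of directions orthogonal to its normal. For the normal e_I these
directions are generated by e_i - e_j within I and e_k outside I. Swapping or zeroing coordinates of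
a rearrangement with the top entries of `u` on I yields them, unless the top `#I` entries coincide
or all others vanish; then tightness freezes a coordinate. This criterion,
`definesFacet_indicatorVec_iff`, gives all four cases. -/

/-- The set cut out by the inequalities `0 ≤ x i` and `∑ i ∈ I, x i ≤ topSum u #I`. -/
def parkingRegion {n : ℕ} (u : Fin n → ℝ) : Set (Fin n → ℝ) :=
  {x | (∀ I : Finset (Fin n), I.Nonempty → ∑ i ∈ I, x i ≤ topSum u #I) ∧ ∀ i, 0 ≤ x i}

/-! ### Parking functions satisfy the inequalities -/

lemma card_filter_val_lt {n k : ℕ} (hk : k ≤ n) : #{j : Fin n | j.val < k} = k := by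
  rw [Fin.card_filter_val_lt, min_eq_right hk]

/-- Subtract the threshold c, the last value of the initial segment: the positive parts of v - c are
supported on that segment and dominate every partial sum. -/
lemma sum_le_sum_initial_of_antitone {n : ℕ} {v : Fin n → ℝ} (hv : Antitone v)
    (J : Finset (Fin n)) : ∑ j ∈ J, v j ≤ ∑ j : Fin n with j.val < #J, v j := by
  rcases J.eq_empty_or_nonempty with rfl | hJ
  · simp
  have hpos := hJ.card_pos
  have hle : #J ≤ n := by simpa using J.card_le_univ
  set c := v ⟨#J - 1, by omega⟩ with hc
  have h1 : ∑ j ∈ J, (v j - c) ≤ ∑ j, max (v j - c) 0 :=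
    (Finset.sum_le_sum fun j _ => le_max_left _ _).trans
      (Finset.sum_le_sum_of_subset_of_nonneg (Finset.subset_univ _)
        fun _ _ _ => le_max_right _ _)
  have h2 : ∑ j, max (v j - c) 0 = ∑ j : Fin n with j.val < #J, (v j - c) := by
    rw [Finset.sum_filter]
    refine Finset.sum_congr rfl fun j _ => ?_
    split_ifs with h
    · exact max_eq_left (sub_nonneg.2 (hv (Fin.le_def.2 (by simp; omega))))
    · exact max_eq_right (sub_nonpos.2 (hv (Fin.le_def.2 (by simp; omega))))
  rw [h2, Finset.sum_sub_distrib, Finset.sum_sub_distrib, Finset.sum_const, Finset.sum_const,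
    card_filter_val_lt hle] at h1
  linarith

lemma sum_le_topSum {n : ℕ} {u : Fin n → ℝ} (hu : Monotone u) (J : Finset (Fin n)) :
    ∑ j ∈ J, u j ≤ topSum u #J := by
  have h := sum_le_sum_initial_of_antitone (v := fun j => u j.rev)
    (fun i j hij => hu (Fin.rev_le_rev.2 hij)) (J.map Fin.revPerm.toEmbedding)
  simpa [topSum] using h

lemma mem_parkingRegion_of_le {n : ℕ} {u a : Fin n → ℝ} (hu : Monotone u) (ha : ∀ i, 0 ≤ a i)
    (σ : Equiv.Perm (Fin n)) (h : ∀ i, a i ≤ u (σ i)) : a ∈ parkingRegion u := by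
  refine ⟨fun I _ => (Finset.sum_le_sum fun i _ => h i).trans ?_, ha⟩
  simpa using sum_le_topSum hu (I.map σ.toEmbedding)

/-- By counting: the i + 1 positions that σ sends to indices at most i all carry entries at most `u
i`, so the sorted entry at i is too. -/
lemma isParkingFunction_of_le {n : ℕ} {u a : Fin n → ℝ} (hu : Monotone u) (ha : ∀ i, 0 ≤ a i)
    (σ : Equiv.Perm (Fin n)) (h : ∀ i, a i ≤ u (σ i)) : IsParkingFunction u a := by
  refine ⟨ha, fun i => ?_⟩
  rw [← Tuple.lt_card_le_iff_apply_le_of_monotone (Tuple.monotone_sort a)]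
  have hsub : (Finset.univ.filter fun j : Fin n => j.val < i.val + 1).map
      ((Tuple.sort a).trans σ).symm.toEmbedding ⊆
      Finset.univ.filter fun j => (a ∘ Tuple.sort a) j ≤ u i := by
    intro j hj
    simp only [Finset.mem_map_equiv, Finset.mem_filter, Finset.mem_univ, true_and,
      Equiv.symm_symm, Equiv.trans_apply] at hj ⊢
    exact (h _).trans (hu (Fin.le_def.2 (by omega)))
  have := Finset.card_le_card hsub
  rw [Finset.card_map, card_filter_val_lt (by omega)] at this
  omega

lemma IsParkingFunction.mem_parkingRegion {n : ℕ} {u a : Fin n → ℝ} (hu : Monotone u)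
    (h : IsParkingFunction u a) : a ∈ parkingRegion u :=
  mem_parkingRegion_of_le hu h.1 (Tuple.sort a).symm fun i => by
    simpa using h.2 ((Tuple.sort a).symm i)

lemma convex_parkingRegion {n : ℕ} (u : Fin n → ℝ) : Convex ℝ (parkingRegion u) := by
  rintro x ⟨hx, hx0⟩ y ⟨hy, hy0⟩ a b ha hb hab
  refine ⟨fun I hI => ?_, fun i => ?_⟩
  · have h1 := mul_le_mul_of_nonneg_left (hx I hI) ha
    have h2 := mul_le_mul_of_nonneg_left (hy I hI) hb
    have h3 : a * topSum u #I + b * topSum u #I = topSum u #I := by rw [← add_mul, hab, one_mul]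
    simp only [Pi.add_apply, Pi.smul_apply, smul_eq_mul, Finset.sum_add_distrib, ← Finset.mul_sum]
    linarith
  · have := mul_nonneg ha (hx0 i)
    have := mul_nonneg hb (hy0 i)
    simp only [Pi.add_apply, Pi.smul_apply, smul_eq_mul]
    linarith

/-! ### Abel summation, greedy bound and separation -/

/-- Abel summation in inductive form: each weighted partial sum is at least the current weight times
the unweighted partial sum. -/
lemma sum_mul_nonneg_of_antitone {n : ℕ} {g w : ℕ → ℝ} (hg : ∀ i, i + 1 < n → g (i + 1) ≤ g i)
    (hg0 : ∀ i < n, 0 ≤ g i) (hw : ∀ k ≤ n, 0 ≤ ∑ i ∈ Finset.range k, w i) :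
    0 ≤ ∑ i ∈ Finset.range n, g i * w i := by
  have key : ∀ k < n, g k * ∑ i ∈ Finset.range (k + 1), w i ≤
      ∑ i ∈ Finset.range (k + 1), g i * w i := by
    intro k
    induction k with
    | zero => simp
    | succ k ih =>
      intro hk
      rw [Finset.sum_range_succ, Finset.sum_range_succ (fun i => g i * w i), mul_add]
      have := mul_le_mul_of_nonneg_right (hg k hk) (hw (k + 1) hk.le)
      have := ih (by omega)
      linarith
  rcases n with _ | n
  · simp
  · exact (mul_nonneg (hg0 n (by omega)) (hw (n + 1) le_rfl)).trans (key n (by omega))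

lemma sum_mul_le_sum_mul_of_antitone {n : ℕ} {g y v : Fin n → ℝ} (hg : Antitone g)
    (hg0 : ∀ i, 0 ≤ g i)
    (h : ∀ k ≤ n, ∑ j : Fin n with j.val < k, y j ≤ ∑ j : Fin n with j.val < k, v j) :
    ∑ i, g i * y i ≤ ∑ i, g i * v i := by
  let ext (f : Fin n → ℝ) (i : ℕ) : ℝ := if hi : i < n then f ⟨i, hi⟩ else 0
  have hext : ∀ (f : Fin n → ℝ) (i : Fin n), ext f i = f i := fun f i => by simp [ext]
  have hsum : ∀ k ≤ n, ∀ f : ℕ → ℝ,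
      ∑ i ∈ Finset.range k, f i = ∑ j : Fin n with j.val < k, f j := by
    intro k hk f
    symm
    refine Finset.sum_bij (fun j _ => j.val) (by simp) (fun _ _ _ _ h => Fin.ext h) ?_ (by simp)
    intro b hb
    exact ⟨⟨b, (Finset.mem_range.1 hb).trans_le hk⟩, by simpa using hb, rfl⟩
  have := sum_mul_nonneg_of_antitone (n := n) (g := ext g) (w := fun i => ext v i - ext y i)
    (fun i hi => by
      have h1 := hext g ⟨i, by omega⟩
      have h2 := hext g ⟨i + 1, hi⟩
      simp only at h1 h2
      rw [h1, h2]
      exact hg (Fin.le_def.2 (Nat.le_succ i)))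
    (fun i hi => by
      have h1 := hext g ⟨i, hi⟩
      simp only at h1
      rw [h1]
      exact hg0 _)
    (fun k hk => by
      rw [hsum k hk]
      simp only [hext, Finset.sum_sub_distrib]
      linarith [h k hk])
  rw [hsum n le_rfl] at this
  simp only [hext, Fin.is_lt, Finset.filter_true, mul_sub, Finset.sum_sub_distrib] at this
  linarith

/-- A linear functional on the region is dominated by its value at a truncation of some
rearrangement of `u`. -/
lemma exists_perm_sum_mul_le {n : ℕ} {u x : Fin n → ℝ} (hx : x ∈ parkingRegion u)
    (h : Fin n → ℝ) : ∃ σ : Equiv.Perm (Fin n),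
      ∑ i, h i * x i ≤ ∑ i, h i * (if 0 < h i then u (σ i) else 0) := by
  -- As x is nonnegative, replacing h by its positive part can only increase the functional at x; τ
  -- then lists g in decreasing order.
  set g : Fin n → ℝ := fun i => max (h i) 0 with hg
  set τ := Tuple.sort (fun i => - g i) with hτ
  have hanti : Antitone (g ∘ τ) := fun i j hij => by
    have := Tuple.monotone_sort (fun i => - g i) hij
    simpa using this
  have hpart : ∀ k ≤ n, ∑ j : Fin n with j.val < k, x (τ j) ≤
      ∑ j : Fin n with j.val < k, u j.rev := by
    intro k hk
    rcases Nat.eq_zero_or_pos k with rfl | hk0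
    · simp
    have hcard : #((Finset.univ.filter fun j : Fin n => j.val < k).map τ.toEmbedding) = k := by
      rw [Finset.card_map, card_filter_val_lt hk]
    have := hx.1 _ (Finset.card_pos.1 (hcard.symm ▸ hk0))
    rw [hcard, Finset.sum_map] at this
    exact this
  refine ⟨τ.symm.trans Fin.revPerm, ?_⟩
  calc ∑ i, h i * x i ≤ ∑ i, g i * x i :=
        Finset.sum_le_sum fun i _ => mul_le_mul_of_nonneg_right (le_max_left _ _) (hx.2 i)
    _ = ∑ i, (g ∘ τ) i * (x ∘ τ) i := (Equiv.sum_comp τ fun i => g i * x i).symm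
    _ ≤ ∑ i, (g ∘ τ) i * u i.rev :=
        sum_mul_le_sum_mul_of_antitone hanti (fun i => le_max_right _ _) hpart
    _ = ∑ i, g i * u (τ.symm i).rev := by
        rw [← Equiv.sum_comp τ fun i => g i * u (τ.symm i).rev]
        simp
    _ = _ := by
        refine Finset.sum_congr rfl fun i _ => ?_
        split_ifs with hi
        · simp [hg, hi.le]
        · simp [hg, not_lt.1 hi]

theorem PF_eq_parkingRegion {n : ℕ} {u : Fin n → ℝ} (hu : Monotone u) (hu0 : ∀ i, 0 ≤ u i) :
    PF u = parkingRegion u := by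
  refine (convexHull_min (fun a ha => ha.mem_parkingRegion hu) (convex_parkingRegion u)).antisymm ?_
  intro x hx
  -- Finitely many truncated rearrangements suffice, and the hull of a finite set is closed, as
  -- strict separation requires.
  let vert (p : Equiv.Perm (Fin n) × Set (Fin n)) : Fin n → ℝ :=
    p.2.indicator fun i => u (p.1 i)
  have hvert : Set.range vert ⊆ {a | IsParkingFunction u a} := by
    rintro _ ⟨p, rfl⟩
    exact isParkingFunction_of_le hu (fun i => Set.indicator_nonneg (fun j _ => hu0 _) i) p.1
      fun i => Set.indicator_le_self' (fun _ _ => hu0 _) i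
  refine convexHull_mono hvert ?_
  by_contra hcon
  obtain ⟨f, c, hlt, hc⟩ := geometric_hahn_banach_closed_point (convex_convexHull ℝ _)
    ((Set.finite_range vert).isClosed_convexHull ℝ) hcon
  have hf : ∀ y : Fin n → ℝ, f y = ∑ i, f (Pi.single i 1) * y i := by
    intro y
    conv_lhs => rw [pi_eq_sum_univ' y]
    simp [map_sum, mul_comm, Pi.single]
  obtain ⟨σ, hσ⟩ := exists_perm_sum_mul_le hx fun i => f (Pi.single i 1)
  have hv : f (vert (σ, {i | 0 < f (Pi.single i 1)})) =
      ∑ i, f (Pi.single i 1) * (if 0 < f (Pi.single i 1) then u (σ i) else 0) := by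
    rw [hf]
    simp [vert, Set.indicator_apply]
  have := hlt _ (subset_convexHull ℝ _ ⟨(σ, {i | 0 < f (Pi.single i 1)}), rfl⟩)
  rw [hv] at this
  rw [hf x] at hc
  linarith

/-! ### Directions of faces and a facet criterion -/

lemma single_mem_direction_of_mem {n : ℕ} {F : Set (Fin n → ℝ)} {x : Fin n → ℝ} {i : Fin n}
    (hx : x ∈ F) (hx' : Function.update x i 0 ∈ F) (hi : x i ≠ 0) :
    Pi.single i 1 ∈ (affineSpan ℝ F).direction := by
  have h := (affineSpan ℝ F).vsub_mem_direction (subset_affineSpan ℝ F hx)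
    (subset_affineSpan ℝ F hx')
  have := (affineSpan ℝ F).direction.smul_mem (x i)⁻¹ h
  convert this using 1
  ext j
  rcases eq_or_ne j i with rfl | hj
  · simp [hi]
  · simp [hj]

lemma single_sub_single_mem_direction_of_mem {n : ℕ} {F : Set (Fin n → ℝ)} {x : Fin n → ℝ}
    {i j : Fin n} (hx : x ∈ F) (hx' : x ∘ Equiv.swap i j ∈ F) (hij : x i ≠ x j) :
    (Pi.single i 1 - Pi.single j 1 : Fin n → ℝ) ∈ (affineSpan ℝ F).direction := by
  have h := (affineSpan ℝ F).vsub_mem_direction (subset_affineSpan ℝ F hx)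
    (subset_affineSpan ℝ F hx')
  have := (affineSpan ℝ F).direction.smul_mem (x i - x j)⁻¹ h
  have hsub : x i - x j ≠ 0 := sub_ne_zero.2 hij
  have hne : i ≠ j := fun h => hij (by rw [h])
  convert this using 1
  ext k
  rcases eq_or_ne k i with rfl | hki
  · simp [hne, hsub]
  rcases eq_or_ne k j with rfl | hkj
  · have : (x i - x k)⁻¹ * (x k - x i) = -1 := by
      rw [← neg_sub (x i), mul_neg, inv_mul_cancel₀ hsub]
    simp [hne.symm, this]
  · simp [hki, hkj, Equiv.swap_apply_of_ne_of_ne]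

/-- The obstruction to being a facet: a functional constant on F kills every direction of F. -/
lemma direction_le_ker {n : ℕ} {F : Set (Fin n → ℝ)} (f : (Fin n → ℝ) →ₗ[ℝ] ℝ) (c : ℝ)
    (h : ∀ x ∈ F, f x = c) : (affineSpan ℝ F).direction ≤ LinearMap.ker f := by
  rw [direction_affineSpan, vectorSpan_def, Submodule.span_le]
  rintro _ ⟨x, hx, y, hy, rfl⟩
  simp [h x hx, h y hy]

/-- A valid inequality attained on a full-dimensional set defines a facet iff the hyperplane of
directions orthogonal to its normal is spanned by the points where it is attained. -/
lemma definesFacet_iff_ker_le_direction {n : ℕ} {P : Set (Fin n → ℝ)} {a : Fin n → ℝ} {b : ℝ}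
    (hP : (affineSpan ℝ P).direction = ⊤) (ha : a ≠ 0) (hvalid : ∀ x ∈ P, a ⬝ᵥ x ≤ b)
    (hne : {x | x ∈ P ∧ a ⬝ᵥ x = b}.Nonempty) :
    DefinesFacet P a b ↔
      ∀ v, a ⬝ᵥ v = 0 → v ∈ (affineSpan ℝ {x | x ∈ P ∧ a ⬝ᵥ x = b}).direction := by
  set F := {x | x ∈ P ∧ a ⬝ᵥ x = b} with hF
  let f : (Fin n → ℝ) →ₗ[ℝ] ℝ := dotProductBilin ℝ ℝ a
  have hf : ∀ v, f v = a ⬝ᵥ v := fun v => rfl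
  obtain ⟨x₀, hx₀P, hx₀⟩ := id hne
  have hface : IsFace P F := by
    refine Or.inr ⟨a, Set.ext fun x => ⟨fun hx => ⟨hx.1, fun y hy => ?_⟩, fun hx => ⟨hx.1, ?_⟩⟩⟩
    · rw [hx.2]
      exact hvalid y hy
    · exact (hvalid x hx.1).antisymm (hx₀ ▸ hx.2 x₀ hx₀P)
  have hle : (affineSpan ℝ F).direction ≤ LinearMap.ker f := direction_le_ker f b fun x hx => hx.2
  have hf0 : f ≠ 0 := fun h => ha <| by
    rw [← dotProduct_self_eq_zero, ← hf, h, LinearMap.zero_apply]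
  have hker : Module.finrank ℝ (LinearMap.ker f) + 1 = n := by
    have := Module.Dual.finrank_ker_add_one_of_ne_zero (f := f) hf0
    simpa using this
  have hdimP : polyDim P = n := by
    rw [polyDim, if_neg (Set.Nonempty.ne_empty ⟨x₀, hx₀P⟩), hP]
    simp
  have hdimF : polyDim F = Module.finrank ℝ (affineSpan ℝ F).direction := by
    rw [polyDim, if_neg hne.ne_empty]
  have hiff : DefinesFacet P a b ↔ polyDim F = polyDim P - 1 :=
    ⟨fun h => h.2.2, fun h => ⟨hvalid, hface, h⟩⟩
  rw [hiff, hdimP, hdimF]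
  constructor
  · intro h v hv
    have : (affineSpan ℝ F).direction = LinearMap.ker f :=
      Submodule.eq_of_le_of_finrank_eq hle (by omega)
    rw [this]
    exact hv
  · intro h
    have : (affineSpan ℝ F).direction = LinearMap.ker f := hle.antisymm h
    rw [this]
    omega

lemma indicatorVec_dotProduct {n : ℕ} (I : Finset (Fin n)) (x : Fin n → ℝ) :
    indicatorVec I ⬝ᵥ x = ∑ i ∈ I, x i := by
  simp [indicatorVec, dotProduct]

lemma forall_indicatorVec_dotProduct_iff {n : ℕ} {I : Finset (Fin n)} (hI : I.Nonempty)
    (D : Submodule ℝ (Fin n → ℝ)) :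
    (∀ v, indicatorVec I ⬝ᵥ v = 0 → v ∈ D) ↔
      (∀ i ∈ I, ∀ j ∈ I, (Pi.single i 1 - Pi.single j 1 : Fin n → ℝ) ∈ D) ∧
        ∀ k ∉ I, (Pi.single k 1 : Fin n → ℝ) ∈ D := by
  constructor
  · refine fun h => ⟨fun i hi j hj => h _ ?_, fun k hk => h _ ?_⟩
    · simp [indicatorVec, hi, hj]
    · simp [indicatorVec, hk]
  · rintro ⟨h1, h2⟩ v hv
    obtain ⟨i₀, hi₀⟩ := hI
    rw [indicatorVec_dotProduct] at hv
    have key : v = ∑ i ∈ I, v i • (Pi.single i 1 - Pi.single i₀ 1 : Fin n → ℝ) +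
        ∑ i ∈ Iᶜ, v i • (Pi.single i 1 : Fin n → ℝ) := by
      simp only [smul_sub, Finset.sum_sub_distrib]
      rw [← Finset.sum_smul, hv, zero_smul, sub_zero, Finset.sum_add_sum_compl]
      ext j
      simp [Finset.sum_apply, Pi.single_apply]
    rw [key]
    exact D.add_mem (D.sum_mem fun i hi => D.smul_mem _ (h1 i hi i₀ hi₀))
      (D.sum_mem fun i hi => D.smul_mem _ (h2 i (Finset.mem_compl.1 hi)))

/-! ### Full dimension and the coordinate facets -/

lemma comp_perm_mem_parkingRegion {n : ℕ} {u x : Fin n → ℝ} (hx : x ∈ parkingRegion u)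
    (σ : Equiv.Perm (Fin n)) : x ∘ σ ∈ parkingRegion u := by
  refine ⟨fun I hI => ?_, fun i => hx.2 _⟩
  simpa using hx.1 (I.map σ.toEmbedding) (hI.map)

lemma update_zero_mem_parkingRegion {n : ℕ} {u x : Fin n → ℝ} (hx : x ∈ parkingRegion u)
    (i : Fin n) : Function.update x i 0 ∈ parkingRegion u := by
  have hle : ∀ j, Function.update x i 0 j ≤ x j := fun j => by
    rcases eq_or_ne j i with rfl | hj
    · simpa using hx.2 j
    · simp [hj]
  refine ⟨fun I hI => (Finset.sum_le_sum fun j _ => hle j).trans (hx.1 I hI), fun j => ?_⟩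
  rcases eq_or_ne j i with rfl | hj
  · simp
  · simpa [hj] using hx.2 j

lemma zero_mem_parkingRegion {n : ℕ} {u : Fin n → ℝ} (hu0 : ∀ i, 0 ≤ u i) :
    (0 : Fin n → ℝ) ∈ parkingRegion u :=
  ⟨fun I _ => by
    simpa [topSum] using Finset.sum_nonneg fun i _ => hu0 _, fun _ => le_rfl⟩

lemma single_mem_parkingRegion {n : ℕ} {u : Fin n → ℝ} (hu : Monotone u) (hu0 : ∀ i, 0 ≤ u i)
    (i p : Fin n) : Pi.single i (u p) ∈ parkingRegion u := by
  refine mem_parkingRegion_of_le hu (fun j => ?_) (Equiv.swap i p) fun j => ?_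
  · rcases eq_or_ne j i with rfl | hj
    · simpa using hu0 p
    · simp [hj]
  · rcases eq_or_ne j i with rfl | hj
    · simp
    · simpa [hj] using hu0 _

lemma direction_parkingRegion {n : ℕ} {u : Fin n → ℝ} (hu : Monotone u) (hu0 : ∀ i, 0 ≤ u i)
    (hne : u ≠ 0) : (affineSpan ℝ (parkingRegion u)).direction = ⊤ := by
  obtain ⟨p, hp⟩ := Function.ne_iff.1 hne
  refine eq_top_iff.2 fun v _ => ?_
  rw [← Finset.univ_sum_single v]
  refine Submodule.sum_mem _ fun i _ => ?_
  have h : (Pi.single i 1 : Fin n → ℝ) ∈ (affineSpan ℝ (parkingRegion u)).direction :=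
    single_mem_direction_of_mem (single_mem_parkingRegion hu hu0 i p)
      (update_zero_mem_parkingRegion (single_mem_parkingRegion hu hu0 i p) i) (by simpa using hp)
  simpa [← Pi.single_smul] using Submodule.smul_mem _ (v i) h

lemma definesFacet_coordinate {n : ℕ} {u : Fin n → ℝ} (hu : Monotone u) (hu0 : ∀ i, 0 ≤ u i)
    (hne : u ≠ 0) (i : Fin n) : DefinesFacet (parkingRegion u) (-Pi.single i 1) 0 := by
  obtain ⟨p, hp⟩ := Function.ne_iff.1 hne
  rw [definesFacet_iff_ker_le_direction (direction_parkingRegion hu hu0 hne)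
    (neg_ne_zero.2 (Pi.single_ne_zero_iff.2 one_ne_zero))
    (fun x hx => by simpa using hx.2 i) ⟨0, zero_mem_parkingRegion hu0, by simp⟩]
  intro v hv
  have hvi : v i = 0 := by simpa using hv
  rw [← Finset.univ_sum_single v]
  refine Submodule.sum_mem _ fun j _ => ?_
  rcases eq_or_ne j i with rfl | hj
  · simp [hvi]
  have h : (Pi.single j 1 : Fin n → ℝ) ∈ (affineSpan ℝ {x | x ∈ parkingRegion u ∧
      (-Pi.single i 1 : Fin n → ℝ) ⬝ᵥ x = 0}).direction := by
    refine single_mem_direction_of_mem (x := Pi.single j (u p))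
      ⟨single_mem_parkingRegion hu hu0 j p, ?_⟩
      ⟨update_zero_mem_parkingRegion (single_mem_parkingRegion hu hu0 j p) j, ?_⟩
      (by simpa using hp)
    · simp [hj.symm]
    · simp [hj.symm]
  simpa [← Pi.single_smul] using Submodule.smul_mem _ (v j) h

/-! ### Facets from subset sums -/

/-- With this σ, `u ∘ σ` places the `#I` largest entries of a monotone `u` on I and so attains the
bound for I. -/
lemma exists_perm_mem_iff {n : ℕ} (I : Finset (Fin n)) :
    ∃ σ : Equiv.Perm (Fin n), ∀ i, i ∈ I ↔ n ≤ (σ i).val + #I := by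
  have hle : #I ≤ n := by simpa using I.card_le_univ
  have hcard : Fintype.card {i // i ∈ I} = Fintype.card {j : Fin n // j.val < #I} := by
    rw [Fintype.card_coe, Fintype.card_subtype, card_filter_val_lt hle]
  let e := Fintype.equivOfCardEq hcard
  refine ⟨e.extendSubtype.trans Fin.revPerm, fun i => ?_⟩
  have : i ∈ I ↔ (e.extendSubtype i).val < #I :=
    ⟨e.extendSubtype_mem i, fun h => by_contra fun hi => e.extendSubtype_not_mem i hi h⟩
  rw [this]
  simp only [Equiv.trans_apply, Fin.revPerm_apply, Fin.val_rev]
  omega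

lemma topSum_eq_sum {n : ℕ} (u : Fin n → ℝ) (k : ℕ) :
    topSum u k = ∑ j : Fin n with n ≤ j.val + k, u j := by
  rw [topSum]
  refine Finset.sum_bij (fun j _ => j.rev) (fun j hj => ?_) (fun _ _ _ _ h => Fin.rev_injective h)
    (fun j hj => ⟨j.rev, ?_, by simp⟩) (fun _ _ => rfl)
  all_goals
    simp only [Finset.mem_filter, Finset.mem_univ, true_and, Fin.val_rev] at hj ⊢
    omega

lemma topSum_one {n : ℕ} (u : Fin n → ℝ) (q : Fin n) (hq : q.val + 1 = n) :
    topSum u 1 = u q := by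
  rw [topSum_eq_sum, Finset.sum_eq_single_of_mem q (by simp [hq])]
  intro j hj hjq
  simp only [Finset.mem_filter, Finset.mem_univ, true_and] at hj
  exact absurd (Fin.ext (by omega)) hjq

lemma topSum_succ {n : ℕ} (u : Fin n → ℝ) (k : ℕ) (p : Fin n) (hp : p.val + (k + 1) = n) :
    topSum u (k + 1) = u p + topSum u k := by
  rw [topSum_eq_sum, topSum_eq_sum, ← Finset.sum_insert (by simp; omega)]
  refine Finset.sum_congr (Finset.ext fun j => ?_) fun _ _ => rfl
  simp only [Finset.mem_filter, Finset.mem_univ, true_and, Finset.mem_insert, Fin.ext_iff]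
  omega

lemma sum_comp_swap {n : ℕ} (x : Fin n → ℝ) {I : Finset (Fin n)} {i j : Fin n}
    (h : i ∈ I ↔ j ∈ I) : ∑ k ∈ I, (x ∘ Equiv.swap i j) k = ∑ k ∈ I, x k := by
  refine Finset.sum_equiv (Equiv.swap i j) (fun k => ?_) fun _ _ => rfl
  rcases eq_or_ne k i with rfl | hki
  · simpa using h
  rcases eq_or_ne k j with rfl | hkj
  · simpa using h.symm
  · rw [Equiv.swap_apply_of_ne_of_ne hki hkj]

/-- The inequality of `I` defines a facet iff the `#I` largest entries of `u` are not all equal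
(or `#I = 1`) and some entry of `u` below them is positive (or `#I = n`). -/
theorem definesFacet_indicatorVec_iff {n : ℕ} {u : Fin n → ℝ} (hu : Monotone u)
    (hu0 : ∀ i, 0 ≤ u i) (hne : u ≠ 0) {I : Finset (Fin n)} (hI : I.Nonempty) :
    DefinesFacet (parkingRegion u) (indicatorVec I) (topSum u #I) ↔
      (#I = 1 ∨ ∃ p q : Fin n, n ≤ p.val + #I ∧ n ≤ q.val + #I ∧ u p ≠ u q) ∧
        (#I = n ∨ ∃ p : Fin n, p.val + #I < n ∧ 0 < u p) := by
  have hIn : #I ≤ n := by simpa using I.card_le_univ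
  have hIpos := hI.card_pos
  obtain ⟨σ, hσ⟩ := exists_perm_mem_iff I
  have haQ : u ∘ σ ∈ parkingRegion u :=
    mem_parkingRegion_of_le hu (fun i => hu0 _) σ fun _ => le_rfl
  have hasum : ∑ i ∈ I, (u ∘ σ) i = topSum u #I := by
    rw [topSum_eq_sum]
    exact Finset.sum_equiv σ (fun i => by simp [hσ]) fun _ _ => rfl
  have hna : indicatorVec I ≠ 0 := by
    obtain ⟨i, hi⟩ := hI
    exact fun h => by simpa [indicatorVec, hi] using congrFun h i
  rw [definesFacet_iff_ker_le_direction (direction_parkingRegion hu hu0 hne) hna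
    (fun x hx => by rw [indicatorVec_dotProduct]; exact hx.1 I hI)
    ⟨u ∘ σ, haQ, by rw [indicatorVec_dotProduct, hasum]⟩,
    forall_indicatorVec_dotProduct_iff hI]
  simp only [indicatorVec_dotProduct]
  set F := {x | x ∈ parkingRegion u ∧ ∑ i ∈ I, x i = topSum u #I} with hF
  have haF : u ∘ σ ∈ F := ⟨haQ, hasum⟩
  have hswap : ∀ i j, (i ∈ I ↔ j ∈ I) → u (σ i) ≠ u (σ j) →
      (Pi.single i 1 - Pi.single j 1 : Fin n → ℝ) ∈ (affineSpan ℝ F).direction := fun i j hij h =>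
    single_sub_single_mem_direction_of_mem haF
      ⟨comp_perm_mem_parkingRegion haQ _, by rw [sum_comp_swap _ hij, hasum]⟩ h
  have hcoord : ∀ (i : Fin n) (c : ℝ), (∀ x ∈ F, x i = c) →
      ∀ v ∈ (affineSpan ℝ F).direction, v i = 0 := fun i c h v hv =>
    direction_le_ker (LinearMap.proj i) c h hv
  refine and_congr ⟨fun h => ?_, fun h i hi j hj => ?_⟩ ⟨fun h => ?_, fun h k hk => ?_⟩
  · by_contra! hcon
    obtain ⟨h1, hconst⟩ := hcon
    obtain ⟨i, hi, j, hj, hij⟩ := Finset.one_lt_card.1 (lt_of_le_of_ne hIpos (Ne.symm h1))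
    obtain ⟨q, hq⟩ : ∃ q : Fin n, q.val + 1 = n := ⟨⟨n - 1, by omega⟩, by simp; omega⟩
    -- The singleton bounds already add up to the bound for I, so tightness forces each of them to
    -- be an equality.
    have hfix : ∀ x ∈ F, x i = u q := by
      intro x hx
      have hle : ∀ k ∈ I, x k ≤ u q := fun k _ => by
        simpa [topSum_one u q hq] using hx.1.1 {k} (Finset.singleton_nonempty k)
      have hsum : ∑ k ∈ I, x k = ∑ k ∈ I, u q := by
        rw [hx.2, ← hasum]
        exact Finset.sum_congr rfl fun k hk => hconst _ _ ((hσ k).1 hk) (by omega)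
      exact (Finset.sum_eq_sum_iff_of_le hle).1 hsum i hi
    have := hcoord i _ hfix _ (h i hi j hj)
    simp [hij] at this
  · rcases h with h1 | ⟨p, q, hp, hq, hpq⟩
    · obtain ⟨k, rfl⟩ := Finset.card_eq_one.1 h1
      rw [Finset.mem_singleton.1 hi, Finset.mem_singleton.1 hj, sub_self]
      exact Submodule.zero_mem _
    by_cases hij : u (σ i) = u (σ j)
    -- Equal values give no direct swap direction, so pass through a third index of I with a
    -- different value.
    · obtain ⟨r, hr, hir⟩ : ∃ r ∈ I, u (σ i) ≠ u (σ r) := by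
        by_cases hip : u (σ i) = u p
        · exact ⟨σ.symm q, (hσ _).2 (by simpa using hq), by simpa [hip] using hpq⟩
        · exact ⟨σ.symm p, (hσ _).2 (by simpa using hp), by simpa using hip⟩
      simpa using Submodule.add_mem _ (hswap i r (by simp [hi, hr]) hir)
        (hswap r j (by simp [hj, hr]) (hij ▸ hir.symm))
    · exact hswap i j (by simp [hi, hj]) hij
  · by_contra! hcon
    obtain ⟨h1, hzero⟩ := hcon
    have hlt : #I < n := lt_of_le_of_ne hIn h1
    obtain ⟨k, hk⟩ : ∃ k, k ∉ I := by
      by_contra! hall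
      exact h1 (by simp [Finset.eq_univ_iff_forall.2 hall])
    obtain ⟨p, hp⟩ : ∃ p : Fin n, p.val + (#I + 1) = n := ⟨⟨n - #I - 1, by omega⟩, by simp; omega⟩
    have hup : u p = 0 := le_antisymm (hzero p (by omega)) (hu0 p)
    -- The bounds for I and for I with k added agree since `u p = 0`, leaving no room for x k.
    have hfix : ∀ x ∈ F, x k = 0 := by
      intro x hx
      have := hx.1.1 (insert k I) (Finset.insert_nonempty k I)
      rw [Finset.sum_insert hk, Finset.card_insert_of_notMem hk, topSum_succ u _ p hp, hup,
        hx.2] at this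
      exact le_antisymm (by linarith) (hx.1.2 k)
    have := hcoord k _ hfix _ (h k hk)
    simp at this
  · have hpos : ∀ l ∉ I, u (σ l) ≠ 0 →
        (Pi.single l 1 : Fin n → ℝ) ∈ (affineSpan ℝ F).direction := fun l hl h =>
      single_mem_direction_of_mem haF ⟨update_zero_mem_parkingRegion haQ l, by
        rw [Finset.sum_update_of_notMem hl, hasum]⟩ h
    rcases h with h1 | ⟨p, hp, hup⟩
    · have : I = Finset.univ := (Finset.card_eq_iff_eq_univ I).1 (by simpa using h1)
      exact absurd (this ▸ Finset.mem_univ k) hk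
    by_cases hk0 : u (σ k) = 0
    -- A zero entry cannot be scaled away; swap it with a positive entry outside I and add that
    -- coordinate direction.
    · have hl : σ.symm p ∉ I := fun h => by
        have := (hσ _).1 h
        simp only [Equiv.apply_symm_apply] at this
        omega
      simpa using Submodule.add_mem _ (hpos _ hl (by simpa using hup.ne'))
        (hswap k (σ.symm p) (by simp [hk, hl]) (by simpa [hk0] using hup.ne))
    · exact hpos k hk hk0

/-! ### Multiplicities and the four cases -/

lemma val_lt_entryCount_zero_iff {n : ℕ} {u : Fin n → ℝ} (hu : Monotone u) (hu0 : ∀ i, 0 ≤ u i)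
    (p : Fin n) : p.val < entryCount u 0 ↔ u p = 0 := by
  have h : entryCount u 0 = #{i | u i ≤ 0} := by
    simp only [entryCount, le_antisymm_iff, hu0, and_true]
  rw [h, Tuple.lt_card_le_iff_apply_le_of_monotone hu]
  exact ⟨fun h => le_antisymm h (hu0 p), fun h => h.le⟩

lemma le_val_add_entryCount_iff {n : ℕ} {u : Fin n → ℝ} (hu : Monotone u) {q : Fin n}
    (hq : q.val + 1 = n) (p : Fin n) : n ≤ p.val + entryCount u (u q) ↔ u p = u q := by
  have hle : ∀ i, u i ≤ u q := fun i => hu (Fin.le_def.2 (by omega))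
  have hcard : #{i | u i < u q} + entryCount u (u q) = n := by
    have h := Finset.card_filter_add_card_filter_not (s := (Finset.univ : Finset (Fin n)))
      fun i => u i < u q
    have heq : entryCount u (u q) = #{i | ¬ u i < u q} := by
      simp only [entryCount, not_lt, le_antisymm_iff, hle, true_and]
    rw [heq, h, Finset.card_univ, Fintype.card_fin]
  have h := Tuple.lt_card_lt_iff_apply_lt_of_monotone (j := p) (a := u q) hu
  have h' : u p = u q ↔ ¬ u p < u q := by
    rw [not_lt]
    exact ⟨fun h => h.ge, fun h => (hle p).antisymm h⟩
  rw [h', ← h]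
  omega

lemma multiplicityVector_last {n : ℕ} {u : Fin n → ℝ} (hu : Monotone u) {q : Fin n}
    (hq : q.val + 1 = n) (hpos : 0 < u q) :
    multiplicityVector u (Fin.last _) = entryCount u (u q) := by
  have hmem : u q ∈ posValues u := by simp [posValues, hpos]
  have hl : 0 < numPosValues u := Finset.card_pos.2 ⟨_, hmem⟩
  -- Stated for general N so that N can be replaced by a successor, where the claim is definitional.
  have hcons : ∀ (N c : ℕ) (f : Fin N → ℕ) (hN : 0 < N),
      (Fin.cons c f : Fin (N + 1) → ℕ) (Fin.last N) = f ⟨N - 1, Nat.sub_lt hN one_pos⟩ := by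
    intro N c f hN
    obtain ⟨N, rfl⟩ := Nat.exists_eq_succ_of_ne_zero hN.ne'
    rfl
  have hdata : dataVector u ⟨numPosValues u - 1, Nat.sub_lt hl one_pos⟩ =
      (posValues u).max' ⟨_, hmem⟩ := Finset.orderEmbOfFin_last rfl hl
  rw [multiplicityVector, hcons _ _ _ hl, hdata]
  congr 1
  refine le_antisymm (Finset.max'_le _ _ _ fun d hd => ?_) (Finset.le_max' _ _ hmem)
  simp only [posValues, Finset.mem_filter, Finset.mem_image, Finset.mem_univ, true_and] at hd
  obtain ⟨⟨i, rfl⟩, -⟩ := hd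
  exact hu (Fin.le_def.2 (by omega))

theorem mainTheorem6 (n : ℕ) (u : Fin n → ℝ) (hmono : Monotone u) (hnonneg : ∀ i, 0 ≤ u i)
    (hne : u ≠ 0) :
    -- the inequality description
    PF u = {x : Fin n → ℝ |
        (∀ I : Finset (Fin n), I.Nonempty → ∑ i ∈ I, x i ≤ topSum u #I) ∧ ∀ i, 0 ≤ x i} ∧
    -- each `x i ≥ 0`, written `-x i ≤ 0`, defines a facet
    (∀ i : Fin n, DefinesFacet (PF u) (-Pi.single i 1) 0) ∧
    -- `u = (d, …, d)`
    ((∃ d : ℝ, 0 < d ∧ ∀ i, u i = d) →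
      ∀ I : Finset (Fin n), I.Nonempty →
        (DefinesFacet (PF u) (indicatorVec I) (topSum u #I) ↔ #I = 1)) ∧
    -- `u = (0, …, 0, d)`
    ((∃ d : ℝ, 0 < d ∧ ∀ i, u i = if i.val + 1 = n then d else 0) →
      ∀ I : Finset (Fin n), I.Nonempty →
        (DefinesFacet (PF u) (indicatorVec I) (topSum u #I) ↔ #I = n)) ∧
    -- `u = (0, …, 0, d, …, d)` with `k ≥ 1` zeros and at least two entries `d`
    ((∃ d : ℝ, 0 < d ∧ ∃ k : ℕ, 1 ≤ k ∧ k + 2 ≤ n ∧ ∀ i, u i = if i.val < k then 0 else d) →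
      ∀ I : Finset (Fin n), I.Nonempty →
        (DefinesFacet (PF u) (indicatorVec I) (topSum u #I) ↔ #I = 1 ∨ #I = n)) ∧
    -- `u` has at least two distinct positive entries
    ((∃ i j, 0 < u i ∧ 0 < u j ∧ u i ≠ u j) →
      ∀ I : Finset (Fin n), I.Nonempty →
        (DefinesFacet (PF u) (indicatorVec I) (topSum u #I) ↔
          #I ∈ ({1, n} ∪ Set.Icc (multiplicityVector u (Fin.last _) + 1)
            (n - multiplicityVector u 0 - 1) : Set ℕ))) := by
  have hPF := PF_eq_parkingRegion hmono hnonneg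
  have hle : ∀ I : Finset (Fin n), #I ≤ n := fun I => by simpa using I.card_le_univ
  refine ⟨hPF, fun i => hPF ▸ definesFacet_coordinate hmono hnonneg hne i, ?_, ?_, ?_, ?_⟩
  · rintro ⟨d, hd, hud⟩ I hI
    have hpos := hI.card_pos
    have hIn := hle I
    rw [hPF, definesFacet_indicatorVec_iff hmono hnonneg hne hI]
    constructor
    · rintro ⟨h | ⟨p, q, -, -, h⟩, -⟩
      · exact h
      · exact absurd ((hud p).trans (hud q).symm) h
    · intro h
      refine ⟨Or.inl h, or_iff_not_imp_left.2 fun hn => ⟨⟨0, by omega⟩, ?_, ?_⟩⟩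
      · simp only
        omega
      · rwa [hud]
  · rintro ⟨d, hd, hud⟩ I hI
    have hpos := hI.card_pos
    have hIn := hle I
    rw [hPF, definesFacet_indicatorVec_iff hmono hnonneg hne hI]
    constructor
    · rintro ⟨-, h | ⟨p, hp, h⟩⟩
      · exact h
      · rw [hud, if_neg (by omega)] at h
        exact absurd h (lt_irrefl 0)
    · intro h
      refine ⟨or_iff_not_imp_left.2 fun h1 =>
        ⟨⟨0, by omega⟩, ⟨n - 1, by omega⟩, ?_, ?_, ?_⟩, Or.inl h⟩
      · simp only
        omega
      · simp only
        omega
      · rw [hud, hud, if_neg (by simp only; omega), if_pos (by simp only; omega)]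
        exact hd.ne
  · rintro ⟨d, hd, k, hk, hkn, hud⟩ I hI
    have hpos := hI.card_pos
    have hIn := hle I
    rw [hPF, definesFacet_indicatorVec_iff hmono hnonneg hne hI]
    constructor
    · rintro ⟨h | ⟨p, q, hp, hq, hpq⟩, h' | ⟨r, hr, hur⟩⟩
      · exact Or.inl h
      · exact Or.inl h
      · exact Or.inr h'
      -- A positive entry below the top `#I` positions makes all of those equal to d.
      · have hkr : ¬ r.val < k := fun h => by simp [hud, h] at hur
        exact absurd (by rw [hud, hud, if_neg (by omega), if_neg (by omega)]) hpq
    · rintro (h | h)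
      · refine ⟨Or.inl h, Or.inr ⟨⟨n - 2, by omega⟩, ?_, ?_⟩⟩
        · simp only
          omega
        · rwa [hud, if_neg (by simp only; omega)]
      · refine ⟨Or.inr ⟨⟨0, by omega⟩, ⟨n - 1, by omega⟩, ?_, ?_, ?_⟩, Or.inl h⟩
        · simp only
          omega
        · simp only
          omega
        · rw [hud, hud, if_pos (by simp only; omega), if_neg (by simp only; omega)]
          exact hd.ne
  · rintro ⟨i, j, hi, hj, hij⟩ I hI
    have hpos := hI.card_pos
    have hIn := hle I
    obtain ⟨q, hq⟩ : ∃ q : Fin n, q.val + 1 = n := ⟨⟨n - 1, by omega⟩, by simp; omega⟩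
    have huq : 0 < u q := hi.trans_le (hmono (Fin.le_def.2 (by omega)))
    have hzero := val_lt_entryCount_zero_iff hmono hnonneg
    have htop := le_val_add_entryCount_iff hmono hq
    have hm0 : multiplicityVector u 0 = entryCount u 0 := rfl
    rw [hPF, definesFacet_indicatorVec_iff hmono hnonneg hne hI,
      multiplicityVector_last hmono hq huq, hm0]
    have htopI : (∃ p q : Fin n, n ≤ p.val + #I ∧ n ≤ q.val + #I ∧ u p ≠ u q) ↔
        entryCount u (u q) < #I := by
      constructor
      · rintro ⟨p, r, hp, hr, hpr⟩
        by_contra! hcon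
        exact hpr (((htop p).1 (by omega)).trans ((htop r).1 (by omega)).symm)
      · intro h
        refine ⟨⟨n - #I, by omega⟩, q, ?_, by omega, fun h' => ?_⟩
        · simp only
          omega
        · have := (htop _).2 h'
          simp only at this
          omega
    have hbelow : (∃ p : Fin n, p.val + #I < n ∧ 0 < u p) ↔ #I + entryCount u 0 < n := by
      constructor
      · rintro ⟨p, hp, hup⟩
        have := mt (hzero p).1 hup.ne'
        omega
      · intro h
        refine ⟨⟨entryCount u 0, by omega⟩, by simp only; omega,
          lt_of_le_of_ne (hnonneg _) fun h' => ?_⟩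
        exact lt_irrefl _ ((hzero ⟨entryCount u 0, by omega⟩).2 h'.symm)
    rw [htopI, hbelow]
    -- Two distinct positive positions give m_0 + 2 ≤ n, which settles `#I = 1` and prevents
    -- truncated subtraction; `hm` settles `#I = n`.
    have hi0 := mt (hzero i).1 hi.ne'
    have hj0 := mt (hzero j).1 hj.ne'
    have hij' : i.val ≠ j.val := fun h => hij (by rw [Fin.ext h])
    have hm : entryCount u (u q) < n := by
      by_contra! hcon
      exact hij (((htop i).1 (by omega)).trans ((htop j).1 (by omega)).symm)
    simp only [Set.mem_union, Set.mem_insert_iff, Set.mem_singleton_iff, Set.mem_Icc]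
    omega
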